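/- Let $n\ge 0$, let $F_n$ be the free group of rank $n$, and let $\partial F_n$ be its boundary, the space of infinite reduced words in the generators and their inverses. Let $\phi:F_n\to F_n$ be an irreducible endomorphism that is not an automorphism. Here a marked graph is a finite connected graph without vertices of valence less than two together with an identification of its fundamental group with $F_n$. A topological representative of $\phi$ is a map $f:G\to G$ of a marked graph that sends vertices to vertices, sends each edge to an immersed edge path or to a vertex, and induces $\phi$ up to an inner automorphism. It is admissible if no forest in $G$ with at least one edge is mapped into itself. The $(i,j)$ entry of its transition matrix is the number of times that $f(e_j)$ crosses $e_i$ in either direction. The endomorphism $\phi$ is irreducible if every admissible topological representative of $\phi$ has a transition matrix $M$ such that for all $p\ge 1$ and all $i,j$ there is $N\ge 1$ with $((M^p)^N)_{ij}>0$. Then: 1. $\phi$ extends continuously to the boundary: there is a unique continuous map $\partial\phi:\partial F_n\to\partial F_n$ such that $\phi(g_k)\to\partial\phi(X)$ whenever $g_k\in F_n$ converges to $X\in\partial F_n$. 2. $\partial\phi$ has at most $2n$ fixed points, and each of them is attracting. (A fixed point $X$ of a map $h$ is attracting if it has a neighbourhood $U$ such that for every neighbourhood $V$ of $X$ there is $K$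 with $h^k(U)\subseteq V$ for all $k\ge K$.) 3. After passing to a power, the fixed points govern the dynamics: there is $p\ge 1$ such that $(\partial\phi)^p$ has finitely many fixed points $X_1,\dots,X_r$, with $r\le 2n$, each of them attracting for $(\partial\phi)^p$, and such that for every compact neighbourhood $N\subseteq\partial F_n$ of $\{X_1,\dots,X_r\}$ there is $K$ with $(\partial\phi)^k(\partial F_n)\subseteq N$ for every $k\ge K$. -/

import Mathlib

open Filter Topology

namespace FreeEndo

/-! ### Graphs, edge paths, marked graphs -/

/-- A finite graph, loops and multiple edges allowed, with a chosen orientation of each edge.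
An oriented edge is a pair `(e, b)`: `(e, true)` runs along `e` and `(e, false)` is its inverse. -/
structure FinGraph where
  nV : ℕ
  nE : ℕ
  src : Fin nE → Fin nV
  tgt : Fin nE → Fin nV

namespace FinGraph

variable (G : FinGraph)

/-- The initial vertex of an oriented edge. -/
def init (a : Fin G.nE × Bool) : Fin G.nV := if a.2 then G.src a.1 else G.tgt a.1

/-- The terminal vertex of an oriented edge. -/
def term (a : Fin G.nE × Bool) : Fin G.nV := if a.2 then G.tgt a.1 else G.src a.1

/-- The list of oriented edges `l` is an edge path (possibly with backtracking) from `u` to `w`. -/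
def IsWalk : Fin G.nV → List (Fin G.nE × Bool) → Fin G.nV → Prop
  | u, [], w => u = w
  | u, a :: l, w => G.init a = u ∧ IsWalk (G.term a) l w

/-- An element of the free group on the edges, seen through its reduced word, is a reduced
(that is, immersed or trivial) edge path from `u` to `w`. The elements `x` with `G.IsPath v x v` form
the fundamental group of `G` based at `v`: homotopy classes of edge paths relative to the
end points correspond to reduced edge paths, and concatenation followed by reduction
is the product in the free group. -/
def IsPath (u : Fin G.nV) (x : FreeGroup (Fin G.nE)) (w : Fin G.nV) : Prop :=
  G.IsWalk u x.toWord w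

def Connected : Prop := ∀ u w, ∃ l, G.IsWalk u l w

/-- The valence of a vertex; a loop counts twice. -/
def valence (v : Fin G.nV) : ℕ :=
  (Finset.univ.filter fun a : Fin G.nE × Bool => G.init a = v).card

/-- The subgraph with edge set `S` is a forest: it carries no nontrivial reduced closed path. -/
def IsForest (S : Set (Fin G.nE)) : Prop :=
  ∀ v x, G.IsPath v x v → (∀ a ∈ x.toWord, a.1 ∈ S) → x = 1

end FinGraph

/-- A marked graph of rank `n`: a finite connected graph without vertices of valence one (or zero),
with an identification of `F_n` with its fundamental group at a base vertex, that is, a homotopy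
equivalence from the rose with `n` petals. -/
structure MarkedGraph (n : ℕ) extends FinGraph where
  connected : toFinGraph.Connected
  two_le_valence : ∀ v, 2 ≤ toFinGraph.valence v
  base : Fin nV
  marking : FreeGroup (Fin n) →* FreeGroup (Fin nE)
  marking_injective : Function.Injective marking
  range_marking : Set.range marking = {x | toFinGraph.IsPath base x base}

/-! ### Topological representatives and irreducibility -/

/-- A topological representative of the outer class of `φ` on the marked graph `G`: vertices go
to vertices, every edge goes to an immersed edge path or to a vertex (`onE e = 1`), and the induced
map on the fundamental group is `φ` up to an inner automorphism. The last condition is expressed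
by a path `γ` from the base vertex to its image; as `γ` is arbitrary, it does not depend on the
choice of `φ` in its outer class. -/
structure TopRep {n : ℕ} (φ : FreeGroup (Fin n) →* FreeGroup (Fin n)) (G : MarkedGraph n) where
  onV : Fin G.nV → Fin G.nV
  onE : Fin G.nE → FreeGroup (Fin G.nE)
  isPath_onE : ∀ e, G.IsPath (onV (G.src e)) (onE e) (onV (G.tgt e))
  induces : ∃ γ, G.IsPath G.base γ (onV G.base) ∧
    ∀ g, γ * FreeGroup.lift onE (G.marking g) * γ⁻¹ = G.marking (φ g)

namespace TopRep

variable {n : ℕ} {φ : FreeGroup (Fin n) →* FreeGroup (Fin n)} {G : MarkedGraph n}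
  (f : TopRep φ G)

/-- The subgraph formed by the edges in `S` and all vertices is mapped into itself. -/
def IsInvariant (S : Set (Fin G.nE)) : Prop :=
  ∀ e ∈ S, ∀ a ∈ (f.onE e).toWord, a.1 ∈ S

/-- There is no invariant forest with at least one edge. -/
def Admissible : Prop :=
  ¬ ∃ S : Set (Fin G.nE), S.Nonempty ∧ G.IsForest S ∧ f.IsInvariant S

/-- The `(i, j)` entry is the number of times the image of the edge `j` crosses the edge `i`, in
either direction. -/
def transitionMatrix : Matrix (Fin G.nE) (Fin G.nE) ℕ :=
  fun i j => ((f.onE j).toWord.map Prod.fst).count i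

end TopRep

/-- (Full) irreducibility of a non-negative integral matrix: for every power `M ^ p` and all `i, j`
some positive power of `M ^ p` has a positive `(i, j)` entry. -/
def FullyIrreducibleMatrix {k : ℕ} (M : Matrix (Fin k) (Fin k) ℕ) : Prop :=
  ∀ p, 1 ≤ p → ∀ i j, ∃ N, 1 ≤ N ∧ 0 < ((M ^ p) ^ N) i j

/-- An endomorphism of `F_n` is irreducible if every admissible topological representative of its
outer class has an irreducible transition matrix. -/
def IsIrreducible {n : ℕ} (φ : FreeGroup (Fin n) →* FreeGroup (Fin n)) : Prop :=
  ∀ (G : MarkedGraph n) (f : TopRep φ G), f.Admissible → FullyIrreducibleMatrix f.transitionMatrix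

/-! ### The boundary of the free group -/

/-- The boundary of `F_n`: infinite reduced words in the generators and their inverses, with the
topology of the product of discrete spaces. -/
abbrev Boundary (n : ℕ) : Type :=
  {X : ℕ → Fin n × Bool // ∀ i, X (i + 1) ≠ ((X i).1, !(X i).2)}

/-- The sequence `g` in `F_n` converges to the boundary point `X`: for every `m`, the reduced word of
`g k` and the infinite word `X` have the same initial segment of length `m` for all large `k`. -/
def ConvergesTo {n : ℕ} (g : ℕ → FreeGroup (Fin n)) (X : Boundary n) : Prop :=
  ∀ m : ℕ, ∀ᶠ k in atTop, (g k).toWord.take m = (List.range m).map X.1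

/-- The initial segment of length `k` of a boundary point. -/
def initialSegment {n : ℕ} (X : Boundary n) (k : ℕ) : FreeGroup (Fin n) :=
  FreeGroup.mk ((List.range k).map X.1)

open Classical in
/-- The boundary map of `φ`: it sends `X` to the limit of the images under `φ` of the initial
segments of `X` (and is the identity at points where this limit does not exist). -/
noncomputable def boundaryMap {n : ℕ} (φ : FreeGroup (Fin n) →* FreeGroup (Fin n))
    (X : Boundary n) : Boundary n :=
  if h : ∃ Y, ConvergesTo (fun k => φ (initialSegment X k)) Y then h.choose else X

/-- `f` extends `φ` continuously to the boundary: if `g k` converges to `X` then `φ (g k)` converges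
to `f X`, and `f` is continuous. -/
def IsBoundaryExtension {n : ℕ} (φ : FreeGroup (Fin n) →* FreeGroup (Fin n))
    (f : Boundary n → Boundary n) : Prop :=
  (∀ g X, ConvergesTo g X → ConvergesTo (fun k => φ (g k)) (f X)) ∧ Continuous f

/-- `x` is an attracting fixed point of `f`: some neighbourhood of `x` shrinks to `x` under the
iterates of `f`. -/
def IsAttractingFixedPt {α : Type*} [TopologicalSpace α] (f : α → α) (x : α) : Prop :=
  Function.IsFixedPt f x ∧
    ∃ U ∈ 𝓝 x, ∀ V ∈ 𝓝 x, ∃ K : ℕ, ∀ k ≥ K, Set.MapsTo f^[k] U V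

end FreeEndo

namespace FreeEndo

/-! ### Cancellation in products of reduced words -/

section Cancellation

variable {β : Type*}

/-! The heart of the proof is that for large `k` every nontrivial element of `φ^k(F_n)` is long, and
that its initial segment of any given length then takes at most `2 * n` values. An irreducible `φ`
kills no basis element, so Nielsen reduction makes it injective (`IsIrreducible.injective`). The
intersection of the images `φ^k(F_n)` is, by an argument of Takahasi type, the image under some
`φ^k` of a free factor of `F_n` (`exists_stableImage_eq_map`). That factor is `φ`-invariant, so
irreducibility makes it trivial or everything, and the latter would make `φ` surjective
(`IsIrreducible.stableImage_eq_bot`). As balls in `F_n` are finite, nontrivial elements of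
`φ^k(F_n)` become arbitrarily long. In a Nielsen reduced basis of `φ^k(F_n)`, a nontrivial product
starts with at least half of its first letter's value, and there are `2 * n` letters
(`IsIrreducible.exists_finset_prefixes`). Injectivity also yields a continuous extension to the
boundary. The nested intersection `Λ` of the ranges of its iterates then has at most `2 * n` points.
By compactness `Λ` absorbs the whole boundary, and the map permutes `Λ`. Fixed points lie in the
finite set `Λ`, hence attract, and some power fixes `Λ` pointwise. -/

theorem isReduced_append_iff {l₁ l₂ : List (β × Bool)} :
    FreeGroup.IsReduced (l₁ ++ l₂) ↔ FreeGroup.IsReduced l₁ ∧ FreeGroup.IsReduced l₂ ∧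
      ∀ x ∈ l₁.getLast?, ∀ y ∈ l₂.head?, x.1 = y.1 → x.2 = y.2 :=
  List.isChain_append

theorem exists_cancellation_list (l₁ : List (β × Bool)) : ∀ l₂ : List (β × Bool),
    FreeGroup.IsReduced l₁ → FreeGroup.IsReduced l₂ →
    ∃ p x' y', l₁ = x' ++ FreeGroup.invRev p ∧ l₂ = p ++ y' ∧ FreeGroup.IsReduced (x' ++ y') := by
  classical
  induction l₁ using List.reverseRecOn with
  | nil => exact fun l₂ _ h₂ => ⟨[], [], l₂, by simp, by simp, by simpa using h₂⟩
  | append_singleton l a ih =>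
    intro l₂ h₁ h₂
    by_cases h : ∃ l₂', l₂ = (a.1, !a.2) :: l₂'
    · obtain ⟨l₂', rfl⟩ := h
      obtain ⟨p, x', y', rfl, rfl, h₃⟩ :=
        ih l₂' (isReduced_append_iff.1 h₁).1 (List.IsChain.tail h₂)
      exact ⟨(a.1, !a.2) :: p, x', y', by simp [FreeGroup.invRev], by simp, h₃⟩
    · refine ⟨[], l ++ [a], l₂, by simp, by simp, isReduced_append_iff.2 ⟨h₁, h₂, ?_⟩⟩
      intro x hx y hy hxy
      cases l₂ with
      | nil => simp at hy
      | cons c l₂ =>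
        simp only [List.getLast?_append, List.getLast?_singleton, Option.some_or,
          Option.mem_some_iff, List.head?_cons] at hx hy
        subst hx hy
        by_contra hne
        refine h ⟨l₂, ?_⟩
        congr 1
        exact Prod.ext hxy.symm (by revert hne; cases a.2 <;> cases c.2 <;> simp)

theorem mk_invRev_mul_mk_append (x' p y' : List (β × Bool)) :
    FreeGroup.mk (x' ++ FreeGroup.invRev p) * FreeGroup.mk (p ++ y') = FreeGroup.mk (x' ++ y') := by
  rw [← FreeGroup.mul_mk, ← FreeGroup.mul_mk, ← FreeGroup.mul_mk, ← FreeGroup.inv_mk]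
  group

variable [DecidableEq β]

theorem toWord_mk_of_isReduced {l : List (β × Bool)} (h : FreeGroup.IsReduced l) :
    (FreeGroup.mk l).toWord = l := by
  rw [FreeGroup.toWord_mk, h.reduce_eq]

theorem toWord_mul_of_isReduced {x y : FreeGroup β} {p x' y' : List (β × Bool)}
    (hx : x.toWord = x' ++ FreeGroup.invRev p) (hy : y.toWord = p ++ y')
    (h : FreeGroup.IsReduced (x' ++ y')) : (x * y).toWord = x' ++ y' := by
  rw [← toWord_mk_of_isReduced h, ← mk_invRev_mul_mk_append x' p y', ← hx, ← hy,
    FreeGroup.mk_toWord, FreeGroup.mk_toWord]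

theorem exists_cancellation (x y : FreeGroup β) :
    ∃ p x' y', x.toWord = x' ++ FreeGroup.invRev p ∧ y.toWord = p ++ y' ∧
      (x * y).toWord = x' ++ y' := by
  obtain ⟨p, x', y', hx, hy, h⟩ := exists_cancellation_list x.toWord y.toWord
    FreeGroup.isReduced_toWord FreeGroup.isReduced_toWord
  exact ⟨p, x', y', hx, hy, toWord_mul_of_isReduced hx hy h⟩

/-- The number of letters of `x` that cancel against letters of `y` in the product `x * y`. -/
def cancel (x y : FreeGroup β) : ℕ :=
  (x.norm + y.norm - (x * y).norm) / 2

theorem exists_cancel (x y : FreeGroup β) :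
    ∃ p x' y', x.toWord = x' ++ FreeGroup.invRev p ∧ y.toWord = p ++ y' ∧
      (x * y).toWord = x' ++ y' ∧ p.length = cancel x y := by
  obtain ⟨p, x', y', hx, hy, h⟩ := exists_cancellation x y
  refine ⟨p, x', y', hx, hy, h, ?_⟩
  simp only [cancel, FreeGroup.norm, hx, hy, h, List.length_append, FreeGroup.invRev_length]
  omega

theorem norm_mul_add_cancel (x y : FreeGroup β) :
    (x * y).norm + 2 * cancel x y = x.norm + y.norm := by
  obtain ⟨p, x', y', hx, hy, h, hp⟩ := exists_cancel x y
  rw [← hp]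
  simp only [FreeGroup.norm, hx, hy, h, List.length_append, FreeGroup.invRev_length]
  omega

theorem cancel_inv_inv (x y : FreeGroup β) : cancel y⁻¹ x⁻¹ = cancel x y := by
  rw [cancel, cancel, ← mul_inv_rev]
  simp only [FreeGroup.norm_inv_eq]
  rw [add_comm]

/-- The cancellation between `x` and `z` only depends on a prefix of `z`. -/
theorem toWord_mul_of_prefix {x y z : FreeGroup β} {e : ℕ} {t : List (β × Bool)}
    (hz : z.toWord = y.toWord.take e ++ t) (he : cancel x y < e) (hy : cancel x y < y.norm) :
    (x * z).toWord = x.toWord.take (x.norm - cancel x y) ++ z.toWord.drop (cancel x y) := by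
  obtain ⟨p, x', y', hx, hy', h, hp⟩ := exists_cancel x y
  rw [← hp] at he hy ⊢
  obtain ⟨a, y'', rfl⟩ : ∃ a y'', y' = a :: y'' := by
    cases y' with
    | nil => simp [FreeGroup.norm, hy'] at hy
    | cons a y'' => exact ⟨a, y'', rfl⟩
  obtain ⟨s, hs⟩ : ∃ s, z.toWord = p ++ a :: s := by
    refine ⟨y''.take (e - p.length - 1) ++ t, ?_⟩
    obtain ⟨d, rfl⟩ : ∃ d, e = p.length + (d + 1) := ⟨e - p.length - 1, by omega⟩
    rw [hz, hy', List.take_length_add_append]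
    simp
  have hred : FreeGroup.IsReduced (x' ++ a :: s) := by
    have h₁ : FreeGroup.IsReduced (x' ++ a :: y'') := h ▸ FreeGroup.isReduced_toWord
    have h₂ : FreeGroup.IsReduced (p ++ a :: s) := hs ▸ FreeGroup.isReduced_toWord
    rw [isReduced_append_iff] at h₁ h₂ ⊢
    exact ⟨h₁.1, h₂.2.1, by simpa using h₁.2.2⟩
  rw [toWord_mul_of_isReduced hx hs hred, hs]
  have : x.norm - p.length = x'.length := by
    simp [FreeGroup.norm, hx]
  rw [this, hx]
  simp

/-- If half of `u` cancelled, `u` would be a conjugate `x' q x'⁻¹` with `q` equal to its own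
inverse; free groups are torsion-free, so `q = 1` and `u = 1`. -/
theorem two_mul_cancel_self_lt {u : FreeGroup β} (hu : u ≠ 1) : 2 * cancel u u < u.norm := by
  obtain ⟨p, x', y', hx, hy, h, hp⟩ := exists_cancel u u
  by_contra! hle
  have hlen : x'.length + p.length = u.norm := by
    simp [FreeGroup.norm, hx]
  obtain ⟨q, rfl⟩ : ∃ q, p = x' ++ q := by
    have h₁ : x' <+: u.toWord := ⟨_, hx.symm⟩
    have h₂ : p <+: u.toWord := ⟨_, hy.symm⟩
    obtain ⟨q, hq⟩ := List.prefix_of_prefix_length_le h₁ h₂ (by omega)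
    exact ⟨q, hq.symm⟩
  have heq : FreeGroup.invRev q ++ FreeGroup.invRev x' = q ++ y' := by
    have := hx.symm.trans hy
    rwa [List.append_assoc, List.append_cancel_left_eq, FreeGroup.invRev_append] at this
  have hq : FreeGroup.invRev q = q := (List.append_inj heq (by simp)).1
  have hq1 : FreeGroup.mk q = 1 := by
    have h₁ : (FreeGroup.mk q)⁻¹ = FreeGroup.mk q := by rw [FreeGroup.inv_mk, hq]
    have h₂ : FreeGroup.mk q ^ 2 = 1 := by
      rw [pow_two]
      nth_rw 1 [← h₁]
      exact inv_mul_cancel _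
    exact (pow_eq_one_iff_left two_ne_zero).1 h₂
  apply hu
  rw [← FreeGroup.mk_toWord (x := u), hx, FreeGroup.invRev_append, hq, ← FreeGroup.mul_mk,
    ← FreeGroup.mul_mk, hq1, ← FreeGroup.inv_mk]
  group

theorem take_toWord_mul {x y : FreeGroup β} {m : ℕ} (h : m + y.norm ≤ x.norm) :
    (x * y).toWord.take m = x.toWord.take m := by
  obtain ⟨p, x', y', hx, hy, hxy⟩ := exists_cancellation x y
  have h₁ : m ≤ x'.length := by
    simp only [FreeGroup.norm, hx, hy, List.length_append, FreeGroup.invRev_length] at h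
    omega
  rw [hxy, hx, List.take_append_of_le_length h₁, List.take_append_of_le_length h₁]

end Cancellation

/-! ### Nielsen reduction -/

section Nielsen

variable {ι : Type*} {H : Type*} [Group H]

/-- The value of a tuple of group elements, indexed by `ι`, on a letter. -/
def letterVal (U : ι → H) (a : ι × Bool) : H := if a.2 then U a.1 else (U a.1)⁻¹

/-- The inverse letter. -/
def flip (a : ι × Bool) : ι × Bool := (a.1, !a.2)

@[simp] theorem flip_flip (a : ι × Bool) : flip (flip a) = a := by simp [flip]

theorem letterVal_flip (U : ι → H) (a : ι × Bool) : letterVal U (flip a) = (letterVal U a)⁻¹ := by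
  obtain ⟨i, b⟩ := a
  cases b <;> simp [letterVal, flip]

theorem lift_mk_cons (U : ι → H) (a : ι × Bool) (l : List (ι × Bool)) :
    FreeGroup.lift U (FreeGroup.mk (a :: l)) =
      letterVal U a * FreeGroup.lift U (FreeGroup.mk l) := by
  obtain ⟨i, b⟩ := a
  cases b <;> simp [letterVal]

theorem map_letterVal {K : Type*} [Group K] (f : H →* K) (U : ι → H) (a : ι × Bool) :
    f (letterVal U a) = letterVal (fun i => f (U i)) a := by
  obtain ⟨i, b⟩ := a
  cases b <;> simp [letterVal]

section Transvection

variable [DecidableEq ι]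

/-- The Nielsen transformation that replaces the letter `d` by `b * d`, for letters `b` and `d` that
belong to different generators. -/
def transvectionHom (b d : ι × Bool) : FreeGroup ι →* FreeGroup ι :=
  FreeGroup.lift fun i => if i = d.1 then
    (if d.2 then letterVal FreeGroup.of b * FreeGroup.of i
      else FreeGroup.of i * (letterVal FreeGroup.of b)⁻¹) else FreeGroup.of i

theorem transvectionHom_letterVal {b d : ι × Bool} (h : b.1 ≠ d.1) (e : ι × Bool) (he : e.1 = b.1) :
    transvectionHom b d (letterVal FreeGroup.of e) = letterVal FreeGroup.of e := by
  rw [map_letterVal]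
  simp [letterVal, transvectionHom, he, h]

theorem transvectionHom_comp_flip {b d : ι × Bool} (h : b.1 ≠ d.1) :
    (transvectionHom b d).comp (transvectionHom (flip b) d) = MonoidHom.id _ := by
  ext i
  have hb := transvectionHom_letterVal h b rfl
  by_cases hi : i = d.1
  · subst hi
    simp only [MonoidHom.comp_apply]
    conv_lhs => arg 2; rw [transvectionHom]
    cases hd : d.2
    · simp [letterVal_flip, hb]
      simp [transvectionHom, hd]
    · simp [letterVal_flip, hb]
      simp [transvectionHom, hd]
  · simp [transvectionHom, hi]

/-- `transvectionHom` as an automorphism. -/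
def transvection (b d : ι × Bool) (h : b.1 ≠ d.1) : FreeGroup ι ≃* FreeGroup ι :=
  MonoidHom.toMulEquiv (transvectionHom b d) (transvectionHom (flip b) d)
    (by have := transvectionHom_comp_flip (b := flip b) (d := d) h; rwa [flip_flip] at this)
    (transvectionHom_comp_flip h)

theorem transvection_of_ne (b d : ι × Bool) (h : b.1 ≠ d.1) {i : ι} (hi : i ≠ d.1) :
    transvection b d h (FreeGroup.of i) = FreeGroup.of i := by
  simp [transvection, transvectionHom, hi]

theorem transvection_letterVal (b d : ι × Bool) (h : b.1 ≠ d.1) :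
    transvection b d h (letterVal FreeGroup.of d) =
      letterVal FreeGroup.of b * letterVal FreeGroup.of d := by
  obtain ⟨i, c⟩ := d
  cases c <;> simp [transvection, transvectionHom, letterVal]

end Transvection

variable {m : ℕ}

/-- The number assigned to a word of given length; it determines the word. -/
def wordCode (l : List (Fin m × Bool)) : ℕ :=
  Nat.ofDigits (2 * m + 2) (l.map fun a => 2 * (a.1 : ℕ) + a.2.toNat)

theorem wordCode_append (p s : List (Fin m × Bool)) :
    wordCode (p ++ s) = wordCode p + (2 * m + 2) ^ p.length * wordCode s := by
  simp [wordCode, Nat.ofDigits_append]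

theorem wordCode_inj {p q : List (Fin m × Bool)} (hl : p.length = q.length)
    (h : wordCode p = wordCode q) : p = q := by
  have hlt : ∀ a : Fin m × Bool, 2 * (a.1 : ℕ) + a.2.toNat < 2 * m + 2 := by
    intro a
    have := a.1.2
    have := Bool.toNat_le a.2
    omega
  have hinj : Function.Injective fun a : Fin m × Bool => 2 * (a.1 : ℕ) + a.2.toNat := by
    rintro ⟨i, b⟩ ⟨j, c⟩ h
    cases b <;> cases c <;> simp at h ⊢ <;> omega
  refine List.map_injective_iff.2 hinj (Nat.ofDigits_inj_of_len_eq (by omega) (by simpa using hl)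
    ?_ ?_ h)
  all_goals
    intro l hl
    obtain ⟨a, -, rfl⟩ := List.mem_map.1 hl
    exact hlt a

/-- The quantity used to choose among tuples of the same total length: the codes of the two halves. -/
def halfCode (w : FreeGroup (Fin m)) : ℕ :=
  wordCode (w.toWord.take (w.norm / 2)) + wordCode (w⁻¹.toWord.take (w.norm / 2))

theorem halfCode_inv (w : FreeGroup (Fin m)) : halfCode w⁻¹ = halfCode w := by
  simp [halfCode, add_comm]

/-- The words `v` and `w` differ only in an initial segment within the first half. So the codes of
the inverse halves agree, and the first halves have a common tail with the same weight: the two half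
codes differ exactly as the codes of `q` and `p` do. -/
theorem wordCode_le_of_halfCode_le {v w : FreeGroup (Fin m)} {p q s : List (Fin m × Bool)}
    (hv : v.toWord = q ++ s) (hw : w.toWord = p ++ s) (hl : p.length = q.length)
    (hq : 2 * q.length ≤ v.norm) (h : halfCode v ≤ halfCode w) : wordCode q ≤ wordCode p := by
  have hn : v.norm = q.length + s.length := by simp [FreeGroup.norm, hv]
  have hn' : w.norm = v.norm := by simp [FreeGroup.norm, hv, hw, hl]
  have hs : v.norm / 2 ≤ s.length := by omega
  simp only [halfCode, hn', FreeGroup.toWord_inv, hv, hw, FreeGroup.invRev_append] at h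
  have hs' : v.norm / 2 ≤ (FreeGroup.invRev s).length := by simpa using hs
  rw [List.take_append_of_le_length hs', List.take_append_of_le_length hs'] at h
  obtain ⟨d, hd⟩ : ∃ d, v.norm / 2 = q.length + d := ⟨v.norm / 2 - q.length, by omega⟩
  rw [hd, List.take_length_add_append, ← hl, List.take_length_add_append, wordCode_append,
    wordCode_append, hl] at h
  omega

/-- A Nielsen reduced tuple of elements of a free group. -/
structure IsNielsenReduced (U : ι → FreeGroup (Fin m)) : Prop where
  ne_one : ∀ i, U i ≠ 1
  two_mul_cancel_le_left : ∀ a b, b ≠ flip a →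
    2 * cancel (letterVal U a) (letterVal U b) ≤ (letterVal U a).norm
  two_mul_cancel_le_right : ∀ a b, b ≠ flip a →
    2 * cancel (letterVal U a) (letterVal U b) ≤ (letterVal U b).norm
  cancel_add_cancel_lt : ∀ a b d, b ≠ flip a → d ≠ flip b →
    cancel (letterVal U a) (letterVal U b) + cancel (letterVal U b) (letterVal U d) <
      (letterVal U b).norm

/-- Among all bases, take one minimising total length and then total half code, lexicographically. A
transvection changes a single summand of each total, so minimality compares `y` with `x * y`. -/
theorem exists_minimal_basis {n : ℕ} (ψ : FreeGroup (Fin n) →* FreeGroup (Fin m)) :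
    ∃ α : FreeGroup (Fin n) ≃* FreeGroup (Fin n), ∀ b d : Fin n × Bool, b.1 ≠ d.1 →
      ∀ x y, x = ψ (α (letterVal FreeGroup.of b)) → y = ψ (α (letterVal FreeGroup.of d)) →
      y.norm ≤ (x * y).norm ∧ ((x * y).norm = y.norm → halfCode y ≤ halfCode (x * y)) := by
  let pot (α : FreeGroup (Fin n) ≃* FreeGroup (Fin n)) : ℕ ×ₗ ℕ :=
    toLex (∑ i, (ψ (α (FreeGroup.of i))).norm, ∑ i, halfCode (ψ (α (FreeGroup.of i))))
  obtain ⟨_, ⟨α, rfl⟩, hα⟩ :=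
    (wellFounded_lt : WellFounded ((· < ·) : ℕ ×ₗ ℕ → ℕ ×ₗ ℕ → Prop)).has_min (Set.range pot)
      ⟨_, ⟨MulEquiv.refl _, rfl⟩⟩
  refine ⟨α, fun b d hbd x y hx hy => ?_⟩
  have hmin := not_lt.1 (hα _ ⟨(transvection b d hbd).trans α, rfl⟩)
  -- Invariance under inversion is needed because `d` may be an inverse generator; `c` collects the
  -- unchanged summands.
  have key : ∀ f : FreeGroup (Fin m) → ℕ, (∀ w, f w⁻¹ = f w) →
      ∃ c, ∑ i, f (ψ (α (FreeGroup.of i))) = f y + c ∧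
        ∑ i, f (ψ (((transvection b d hbd).trans α) (FreeGroup.of i))) = f (x * y) + c := by
    intro f hf
    have hletter : ∀ α' : FreeGroup (Fin n) ≃* FreeGroup (Fin n),
        f (ψ (α' (FreeGroup.of d.1))) = f (ψ (α' (letterVal FreeGroup.of d))) := by
      intro α'
      obtain ⟨i, c⟩ := d
      cases c <;> simp [letterVal, hf]
    refine ⟨∑ i ∈ Finset.univ.erase d.1, f (ψ (α (FreeGroup.of i))), ?_, ?_⟩
    · rw [← Finset.add_sum_erase _ _ (Finset.mem_univ d.1), hletter, hy]
    · rw [← Finset.add_sum_erase _ _ (Finset.mem_univ d.1), hletter]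
      congr 1
      · rw [MulEquiv.trans_apply, transvection_letterVal, map_mul, map_mul, hx, hy]
      · refine Finset.sum_congr rfl fun i hi => ?_
        rw [MulEquiv.trans_apply, transvection_of_ne _ _ _ (Finset.ne_of_mem_erase hi)]
  obtain ⟨c₁, h₁, h₁'⟩ := key FreeGroup.norm fun w => FreeGroup.norm_inv_eq
  obtain ⟨c₂, h₂, h₂'⟩ := key halfCode halfCode_inv
  simp only [pot, h₁, h₁', h₂, h₂', Prod.Lex.toLex_le_toLex] at hmin
  constructor <;> omega

/-- Minimal length gives the two half-cancellation bounds; the half codes exclude a middle letter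
that is cancelled entirely from both sides. -/
theorem exists_isNielsenReduced {n : ℕ} (ψ : FreeGroup (Fin n) →* FreeGroup (Fin m))
    (hψ : ∀ (α : FreeGroup (Fin n) ≃* FreeGroup (Fin n)) i, ψ (α (FreeGroup.of i)) ≠ 1) :
    ∃ α : FreeGroup (Fin n) ≃* FreeGroup (Fin n),
      IsNielsenReduced fun i => ψ (α (FreeGroup.of i)) := by
  obtain ⟨α, hα⟩ := exists_minimal_basis ψ
  refine ⟨α, ?_⟩
  set U := fun i => ψ (α (FreeGroup.of i)) with hU
  have hval : ∀ a, ψ (α (letterVal FreeGroup.of a)) = letterVal U a := by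
    intro a
    exact map_letterVal (ψ.comp α.toMonoidHom) FreeGroup.of a
  have hne : ∀ a, letterVal U a ≠ 1 := by
    rintro ⟨i, b⟩
    cases b <;> simpa [letterVal] using hψ α i
  have hmin : ∀ b d : Fin n × Bool, b.1 ≠ d.1 →
      (letterVal U d).norm ≤ (letterVal U b * letterVal U d).norm ∧
        ((letterVal U b * letterVal U d).norm = (letterVal U d).norm →
          halfCode (letterVal U d) ≤ halfCode (letterVal U b * letterVal U d)) :=
    fun b d h => hα b d h _ _ (hval b).symm (hval d).symm
  have heq : ∀ a b : Fin n × Bool, b ≠ flip a → a.1 = b.1 → b = a := by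
    rintro ⟨i, a⟩ ⟨j, b⟩ h rfl
    cases a <;> cases b <;> simp_all [flip]
  have hleft : ∀ a b, b ≠ flip a →
      2 * cancel (letterVal U a) (letterVal U b) ≤ (letterVal U a).norm := by
    intro a b h
    by_cases hab : a.1 = b.1
    · rw [heq a b h hab]
      exact (two_mul_cancel_self_lt (hne a)).le
    · have := (hmin a b hab).1
      have := norm_mul_add_cancel (letterVal U a) (letterVal U b)
      omega
  have hflip : ∀ a b : Fin n × Bool, b ≠ flip a → flip a ≠ flip (flip b) := by
    intro a b h h'
    rw [flip_flip] at h'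
    exact h h'.symm
  have hright : ∀ a b, b ≠ flip a →
      2 * cancel (letterVal U a) (letterVal U b) ≤ (letterVal U b).norm := by
    intro a b h
    have := hleft (flip b) (flip a) (hflip a b h)
    rwa [letterVal_flip, letterVal_flip, cancel_inv_inv, FreeGroup.norm_inv_eq] at this
  refine ⟨hψ α, hleft, hright, fun a b d hab hbd => ?_⟩
  by_contra! hle
  have h₁ := hleft a b hab
  have h₂ := hright a b hab
  have h₃ := hleft b d hbd
  have h₄ := hright b d hbd
  have hab' : a.1 ≠ b.1 := by
    intro h
    rw [heq a b hab h] at h₂ hle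
    have := two_mul_cancel_self_lt (hne a)
    rw [heq a b hab h] at h₃
    omega
  have hbd' : b.1 ≠ d.1 := by
    intro h
    rw [heq b d hbd h] at h₃ hle
    have := two_mul_cancel_self_lt (hne b)
    omega
  -- Exactly half of `b` cancels on either side, so `b` is `p q⁻¹` with `p` and `q` of equal length.
  -- Replacing `d` by `b d`, or `a⁻¹` by `b⁻¹ a⁻¹`, keeps the length; the two code comparisons force
  -- `p = q`, hence `b = 1`.
  obtain ⟨p, x', y', hx, hy, hxy, hp⟩ := exists_cancel (letterVal U a) (letterVal U b)
  obtain ⟨q, x'', z', hb, hz, hbz, hq⟩ := exists_cancel (letterVal U b) (letterVal U d)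
  have hpq : p.length = q.length := by omega
  have hlen : (letterVal U b).norm = x''.length + q.length := by simp [FreeGroup.norm, hb]
  obtain ⟨rfl, rfl⟩ := List.append_inj (hb.symm.trans hy) (by omega)
  have hqp : wordCode q ≤ wordCode x'' := by
    refine wordCode_le_of_halfCode_le hz hbz hpq (by omega) ((hmin b d hbd').2 ?_)
    simp [FreeGroup.norm, hbz, hz, hpq]
  have hpq' : wordCode x'' ≤ wordCode q := by
    have hv : (letterVal U (flip a)).toWord = x'' ++ FreeGroup.invRev x' := by
      rw [letterVal_flip, FreeGroup.toWord_inv, hx]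
      simp
    have hw : (letterVal U (flip b) * letterVal U (flip a)).toWord = q ++ FreeGroup.invRev x' := by
      rw [letterVal_flip, letterVal_flip, ← mul_inv_rev, FreeGroup.toWord_inv, hxy]
      simp
    refine wordCode_le_of_halfCode_le hv hw hpq.symm ?_
      ((hmin (flip b) (flip a) (Ne.symm hab')).2 ?_)
    · rw [letterVal_flip, FreeGroup.norm_inv_eq]
      omega
    · simp [FreeGroup.norm, hv, hw, hpq]
  have hpq_eq := wordCode_inj hpq (le_antisymm hpq' hqp)
  apply hne b
  rw [← FreeGroup.mk_toWord (x := letterVal U b), hb, hpq_eq, ← FreeGroup.mul_mk,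
    ← FreeGroup.inv_mk, mul_inv_cancel]

/-- The product of a reduced word in a Nielsen reduced tuple starts with at least half of the
value of its first letter, and is at least as long as the value of each of its letters. -/
theorem IsNielsenReduced.lift_mk_cons_aux [DecidableEq ι] {U : ι → FreeGroup (Fin m)}
    (hU : IsNielsenReduced U)
    (l : List (ι × Bool)) : ∀ a, FreeGroup.IsReduced (a :: l) →
    (∃ k t, (FreeGroup.lift U (FreeGroup.mk (a :: l))).toWord = (letterVal U a).toWord.take k ++ t ∧
      k ≤ (letterVal U a).norm ∧ (letterVal U a).norm ≤ 2 * k ∧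
      ∀ e, a ≠ flip e → cancel (letterVal U e) (letterVal U a) < k) ∧
    ∀ b ∈ a :: l, (letterVal U b).norm ≤ (FreeGroup.lift U (FreeGroup.mk (a :: l))).norm := by
  have hne : ∀ a, 0 < (letterVal U a).norm := by
    rintro ⟨i, b⟩
    rw [Nat.pos_iff_ne_zero, Ne, FreeGroup.norm_eq_zero]
    cases b <;> simpa [letterVal] using hU.ne_one i
  induction l with
  | nil =>
    intro a _
    have : FreeGroup.lift U (FreeGroup.mk [a]) = letterVal U a := by
      rw [lift_mk_cons, ← FreeGroup.one_eq_mk, map_one, mul_one]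
    rw [this]
    refine ⟨⟨_, [], by rw [FreeGroup.norm, List.take_length, List.append_nil], le_rfl, by omega, ?_⟩,
      by simp⟩
    intro e he
    have := hU.two_mul_cancel_le_right e a he
    have := hne a
    omega
  | cons b l ih =>
    intro a hred
    obtain ⟨⟨k, t, hk, hk₁, hk₂, hk₃⟩, hlen⟩ := ih b (List.IsChain.tail hred)
    have hab : b ≠ flip a := by
      intro h
      have := (List.isChain_cons_cons.1 hred).1
      rw [h] at this
      simp [flip] at this
    rw [lift_mk_cons]
    set g := FreeGroup.lift U (FreeGroup.mk (b :: l))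
    have hmul := toWord_mul_of_prefix hk (hk₃ a hab) (lt_of_lt_of_le (hk₃ a hab) hk₁)
    have h₁ := hU.two_mul_cancel_le_left a b hab
    have h₂ := hU.two_mul_cancel_le_right a b hab
    have h₃ := hlen b (by simp)
    have hnorm : (letterVal U a * g).norm + 2 * cancel (letterVal U a) (letterVal U b) =
        (letterVal U a).norm + g.norm := by
      conv_lhs => rw [FreeGroup.norm, hmul]
      simp only [List.length_append, List.length_take, List.length_drop]
      simp only [FreeGroup.norm] at h₁ h₂ h₃ ⊢
      omega
    -- The new `k` is the length of `a` minus its cancellation with `b`; `cancel_add_cancel_lt` says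
    -- that a letter put in front of `a` cannot eat all of it.
    refine ⟨⟨_, _, hmul, by omega, by omega, ?_⟩, ?_⟩
    · intro e he
      have := hU.cancel_add_cancel_lt e a b he hab
      omega
    · intro c hc
      rcases List.mem_cons.1 hc with rfl | hc
      · omega
      · have := hlen c hc
        omega

theorem IsNielsenReduced.injective [DecidableEq ι] {U : ι → FreeGroup (Fin m)}
    (hU : IsNielsenReduced U) : Function.Injective (FreeGroup.lift U) := by
  rw [injective_iff_map_eq_one]
  intro g hg
  by_contra hne
  obtain ⟨a, l, hal⟩ := List.exists_cons_of_ne_nil (mt FreeGroup.toWord_eq_nil_iff.1 hne)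
  have h := (hU.lift_mk_cons_aux l a (hal ▸ FreeGroup.isReduced_toWord)).2 a (by simp)
  rw [← hal, FreeGroup.mk_toWord, hg, FreeGroup.norm_one, Nat.le_zero, FreeGroup.norm_eq_zero] at h
  obtain ⟨i, b⟩ := a
  have := hU.ne_one i
  cases b <;> simp_all [letterVal]

/-- Consequently the elements of length at most `L` lie in the free factor generated by the basis
elements of length at most `L`. -/
theorem IsNielsenReduced.norm_letter_le [DecidableEq ι] {U : ι → FreeGroup (Fin m)}
    (hU : IsNielsenReduced U) (g : FreeGroup ι) {a : ι × Bool} (ha : a ∈ g.toWord) :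
    (U a.1).norm ≤ (FreeGroup.lift U g).norm := by
  cases hg : g.toWord with
  | nil => simp [hg] at ha
  | cons b l =>
    have h := (hU.lift_mk_cons_aux l b (hg ▸ FreeGroup.isReduced_toWord)).2 a (hg ▸ ha)
    rw [← hg, FreeGroup.mk_toWord] at h
    obtain ⟨i, c⟩ := a
    cases c <;> simpa [letterVal] using h

theorem IsNielsenReduced.take_toWord_lift [DecidableEq ι] {U : ι → FreeGroup (Fin m)}
    (hU : IsNielsenReduced U) {r : ℕ} (hr : ∀ i, 2 * r ≤ (U i).norm) {g : FreeGroup ι}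
    (hg : g ≠ 1) : ∃ a, (FreeGroup.lift U g).toWord.take r = (letterVal U a).toWord.take r := by
  obtain ⟨a, l, hal⟩ := List.exists_cons_of_ne_nil (mt FreeGroup.toWord_eq_nil_iff.1 hg)
  obtain ⟨k, t, hk, hk₁, hk₂, -⟩ :=
    (hU.lift_mk_cons_aux l a (hal ▸ FreeGroup.isReduced_toWord)).1
  rw [← hal, FreeGroup.mk_toWord] at hk
  refine ⟨a, ?_⟩
  have hra : 2 * r ≤ (letterVal U a).norm := by
    obtain ⟨i, c⟩ := a
    cases c <;> simpa [letterVal] using hr i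
  rw [hk, List.take_append_of_le_length, List.take_take, min_eq_left (by omega)]
  simp only [FreeGroup.norm] at *
  rw [List.length_take]
  omega

end Nielsen

/-! ### Irreducible endomorphisms on roses -/

section Rose

variable {n : ℕ}

theorem FinGraph.isWalk_of_subsingleton (G : FinGraph) [Subsingleton (Fin G.nV)]
    (l : List (Fin G.nE × Bool)) : ∀ u w, G.IsWalk u l w := by
  induction l with
  | nil => exact fun u w => Subsingleton.elim u w
  | cons a l ih => exact fun u w => ⟨Subsingleton.elim _ _, ih _ _⟩

/-- The rose with `n` petals, marked by an automorphism of the free group. -/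
def rose (hn : 0 < n) (β : FreeGroup (Fin n) ≃* FreeGroup (Fin n)) : MarkedGraph n where
  nV := 1
  nE := n
  src _ := 0
  tgt _ := 0
  connected u w := ⟨[], Subsingleton.elim u w⟩
  two_le_valence v := by
    have : ∀ a, FinGraph.init ⟨1, n, fun _ => 0, fun _ => 0⟩ a = v :=
      fun a => Subsingleton.elim (α := Fin 1) _ _
    simp only [FinGraph.valence, this, Finset.filter_true, Finset.card_univ, Fintype.card_prod,
      Fintype.card_fin, Fintype.card_bool]
    omega
  base := 0
  marking := β.toMonoidHom
  marking_injective := β.injective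
  range_marking := by
    ext x
    refine ⟨fun _ => ?_, fun _ => β.surjective x⟩
    have : Subsingleton (Fin (FinGraph.mk 1 n (fun _ => 0) fun _ => 0).nV) :=
      inferInstanceAs (Subsingleton (Fin 1))
    exact FinGraph.isWalk_of_subsingleton _ _ _ _

instance (hn : 0 < n) (β : FreeGroup (Fin n) ≃* FreeGroup (Fin n)) :
    Subsingleton (Fin (rose hn β).nV) := inferInstanceAs (Subsingleton (Fin 1))

/-- The representative of `φ` on the rose whose petals are the basis `α (of i)`. -/
def roseRep (φ : FreeGroup (Fin n) →* FreeGroup (Fin n)) (hn : 0 < n)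
    (α : FreeGroup (Fin n) ≃* FreeGroup (Fin n)) : TopRep φ (rose hn α.symm) where
  onV := id
  onE i := α.symm (φ (α (FreeGroup.of i)))
  isPath_onE _ := FinGraph.isWalk_of_subsingleton _ _ _ _
  induces := by
    refine ⟨1, FinGraph.isWalk_of_subsingleton _ _ _ _, fun g => ?_⟩
    have h : (FreeGroup.lift fun i => α.symm (φ (α (FreeGroup.of i)))) =
        (α.symm.toMonoidHom.comp φ).comp α.toMonoidHom := by
      ext i
      simp
    change 1 * (FreeGroup.lift fun i => α.symm (φ (α (FreeGroup.of i)))) (α.symm g) * 1⁻¹ =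
      α.symm (φ g)
    rw [h]
    simp

/-- Every petal is a loop, so a forest in a rose has no edges. -/
theorem roseRep_admissible (φ : FreeGroup (Fin n) →* FreeGroup (Fin n)) (hn : 0 < n)
    (α : FreeGroup (Fin n) ≃* FreeGroup (Fin n)) : (roseRep φ hn α).Admissible := by
  rintro ⟨S, ⟨e, he⟩, hS, -⟩
  refine FreeGroup.of_ne_one e (hS (rose hn α.symm).base (FreeGroup.of e) ?_ ?_)
  · exact FinGraph.isWalk_of_subsingleton _ _ _ _
  · intro a ha
    rw [FreeGroup.toWord_of, List.mem_singleton] at ha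
    rw [ha]
    exact he

variable {φ : FreeGroup (Fin n) →* FreeGroup (Fin n)}

/-- The transition matrix of `φ` on the rose whose petals are the basis `α (of i)`. -/
def basisMatrix (φ : FreeGroup (Fin n) →* FreeGroup (Fin n))
    (α : FreeGroup (Fin n) ≃* FreeGroup (Fin n)) : Matrix (Fin n) (Fin n) ℕ :=
  fun i j => ((α.symm (φ (α (FreeGroup.of j)))).toWord.map Prod.fst).count i

theorem IsIrreducible.exists_pow_pos (hφ : IsIrreducible φ)
    (α : FreeGroup (Fin n) ≃* FreeGroup (Fin n)) (i j : Fin n) :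
    ∃ N, 0 < (basisMatrix φ α ^ (N + 1)) i j := by
  obtain ⟨N, hN, h⟩ := hφ _ _ (roseRep_admissible φ i.pos α) 1 le_rfl i j
  obtain ⟨N, rfl⟩ := Nat.exists_eq_add_of_le' hN
  rw [pow_one] at h
  exact ⟨N, h⟩

/-- A killed basis element gives a zero column, which stays zero in all positive powers of the
matrix. -/
theorem IsIrreducible.apply_basis_ne_one (hφ : IsIrreducible φ)
    (α : FreeGroup (Fin n) ≃* FreeGroup (Fin n)) (i : Fin n) : φ (α (FreeGroup.of i)) ≠ 1 := by
  intro h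
  obtain ⟨N, hN⟩ := hφ.exists_pow_pos α i i
  rw [pow_succ, Matrix.mul_apply] at hN
  simp [basisMatrix, h] at hN

/-- This is the form in which irreducibility is used: no proper nontrivial free factor is mapped
into itself. A positive entry of a matrix power is a chain of crossings, which cannot leave `S`. -/
theorem IsIrreducible.eq_univ_of_invariant (hφ : IsIrreducible φ)
    (α : FreeGroup (Fin n) ≃* FreeGroup (Fin n)) {S : Set (Fin n)} (hS : S.Nonempty)
    (hinv : ∀ s ∈ S, ∀ a ∈ (α.symm (φ (α (FreeGroup.of s)))).toWord, a.1 ∈ S) : S = Set.univ := by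
  obtain ⟨j, hj⟩ := hS
  refine Set.eq_univ_of_forall fun i => ?_
  have key : ∀ N : ℕ, ∀ i, 0 < (basisMatrix φ α ^ N) i j → i ∈ S := by
    intro N
    induction N with
    | zero =>
      intro i hi
      rw [pow_zero, Matrix.one_apply] at hi
      split_ifs at hi with h
      · exact h ▸ hj
      · exact absurd hi (lt_irrefl _)
    | succ N ih =>
      intro i hi
      rw [pow_succ', Matrix.mul_apply] at hi
      obtain ⟨l, -, hl⟩ := Finset.sum_pos_iff.1 hi
      obtain ⟨a, ha, rfl⟩ :=
        List.mem_map.1 (List.count_pos_iff.1 (Nat.pos_of_ne_zero (left_ne_zero_of_mul hl.ne')))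
      exact hinv l (ih l (Nat.pos_of_ne_zero (right_ne_zero_of_mul hl.ne'))) a ha
  obtain ⟨N, hN⟩ := hφ.exists_pow_pos α i j
  exact key _ i hN

theorem IsIrreducible.injective (hφ : IsIrreducible φ) : Function.Injective φ := by
  obtain ⟨α, hα⟩ := exists_isNielsenReduced φ fun α i => hφ.apply_basis_ne_one α i
  have h : ⇑φ ∘ α = FreeGroup.lift fun i => φ (α (FreeGroup.of i)) := by
    have : φ.comp α.toMonoidHom = FreeGroup.lift fun i => φ (α (FreeGroup.of i)) := by
      ext i
      simp
    rw [← this]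
    rfl
  rw [← Function.Injective.of_comp_iff' _ α.bijective, h]
  exact hα.injective

end Rose

/-! ### The intersection of the images of the iterates -/

section Iterates

variable {n : ℕ}

theorem finite_norm_le {β : Type*} [Finite β] [DecidableEq β] (L : ℕ) :
    {x : FreeGroup β | x.norm ≤ L}.Finite :=
  (List.finite_length_le (β × Bool) L).preimage FreeGroup.toWord_injective.injOn

theorem mem_closure_of_image_iff {β : Type*} [DecidableEq β] {S : Set β} {g : FreeGroup β} :
    g ∈ Subgroup.closure (FreeGroup.of '' S) ↔ ∀ a ∈ g.toWord, a.1 ∈ S := by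
  constructor
  · intro hg
    induction hg using Subgroup.closure_induction with
    | mem x hx =>
      obtain ⟨s, hs, rfl⟩ := hx
      simpa using hs
    | one => simp
    | mul x y _ _ hx hy =>
      intro a ha
      rcases List.mem_append.1 ((FreeGroup.toWord_mul_sublist x y).subset ha) with h | h
      · exact hx a h
      · exact hy a h
    | inv x _ hx =>
      intro a ha
      simp only [FreeGroup.toWord_inv, FreeGroup.invRev, List.mem_reverse, List.mem_map] at ha
      obtain ⟨b, hb, rfl⟩ := ha
      exact hx b hb
  · intro h
    rw [← FreeGroup.mk_toWord (x := g)]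
    generalize g.toWord = l at h
    induction l with
    | nil => exact one_mem _
    | cons a l ih =>
      rw [← List.singleton_append, ← FreeGroup.mul_mk]
      refine mul_mem ?_ (ih fun b hb => h b (List.mem_cons_of_mem _ hb))
      have ha : FreeGroup.of a.1 ∈ Subgroup.closure (FreeGroup.of '' S) :=
        Subgroup.subset_closure ⟨a.1, h a List.mem_cons_self, rfl⟩
      obtain ⟨i, b⟩ := a
      cases b
      · exact inv_mem ha
      · exact ha

/-- Both sets give bases of one free group, whose rank is well defined. -/
theorem ncard_eq_of_map_closure_eq {β γ H : Type*} [Group H] {f : FreeGroup β →* H}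
    {f' : FreeGroup γ →* H} (hf : Function.Injective f) (hf' : Function.Injective f') {S : Set β}
    {S' : Set γ} (h : (Subgroup.closure (FreeGroup.of '' S)).map f =
      (Subgroup.closure (FreeGroup.of '' S')).map f') : S.ncard = S'.ncard := by
  have hr : (f.comp (FreeGroup.map ((↑) : S → β))).range =
      (f'.comp (FreeGroup.map ((↑) : S' → γ))).range := by
    rw [MonoidHom.range_comp, MonoidHom.range_comp, FreeGroup.range_map, FreeGroup.range_map,
      Subtype.range_coe, Subtype.range_coe, h]
  have e₁ := MonoidHom.ofInjective (f := f.comp (FreeGroup.map ((↑) : S → β)))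
    (hf.comp (FreeGroup.map_injective Subtype.val_injective))
  have e₂ := MonoidHom.ofInjective (f := f'.comp (FreeGroup.map ((↑) : S' → γ)))
    (hf'.comp (FreeGroup.map_injective Subtype.val_injective))
  exact Nat.card_congr (Equiv.ofFreeGroupEquiv
    ((e₁.trans (MulEquiv.subgroupCongr hr)).trans e₂.symm))

/-- The iterates of an endomorphism, as homomorphisms. -/
def iter {H : Type*} [Group H] (φ : H →* H) : ℕ → H →* H
  | 0 => MonoidHom.id H
  | k + 1 => (iter φ k).comp φ

theorem iter_apply {H : Type*} [Group H] (φ : H →* H) (k : ℕ) : ∀ g, iter φ k g = φ^[k] g := by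
  induction k with
  | zero => exact fun g => rfl
  | succ k ih => exact fun g => ih (φ g)

variable {φ : FreeGroup (Fin n) →* FreeGroup (Fin n)}

theorem iter_injective (h : Function.Injective φ) (k : ℕ) : Function.Injective (iter φ k) := by
  have : ⇑(iter φ k) = φ^[k] := funext (iter_apply φ k)
  rw [this]
  exact h.iterate k

theorem exists_isNielsenReduced_of_injective {m : ℕ} {ψ : FreeGroup (Fin n) →* FreeGroup (Fin m)}
    (hψ : Function.Injective ψ) : ∃ α : FreeGroup (Fin n) ≃* FreeGroup (Fin n),
      IsNielsenReduced fun i => ψ (α (FreeGroup.of i)) :=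
  exists_isNielsenReduced ψ fun α i h => FreeGroup.of_ne_one i <| by
    rwa [map_eq_one_iff ψ hψ, map_eq_one_iff α α.injective] at h

theorem lift_basis {m : ℕ} (ψ : FreeGroup (Fin n) →* FreeGroup (Fin m))
    (α : FreeGroup (Fin n) ≃* FreeGroup (Fin n)) (g : FreeGroup (Fin n)) :
    FreeGroup.lift (fun i => ψ (α (FreeGroup.of i))) g = ψ (α g) := by
  have : FreeGroup.lift (fun i => ψ (α (FreeGroup.of i))) = ψ.comp α.toMonoidHom := by
    ext i
    simp
  rw [this]
  rfl

/-- The elements that lie in the image of every iterate of `φ`. -/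
def stableImage (φ : FreeGroup (Fin n) →* FreeGroup (Fin n)) : Subgroup (FreeGroup (Fin n)) :=
  ⨅ k, (iter φ k).range

theorem range_iter_antitone (φ : FreeGroup (Fin n) →* FreeGroup (Fin n)) :
    Antitone fun k => (iter φ k).range := by
  refine antitone_nat_of_succ_le fun k => ?_
  rintro _ ⟨g, rfl⟩
  exact ⟨φ g, by rw [iter_apply, iter_apply, Function.iterate_succ_apply]⟩

/-- Only finitely many elements are this short, and each one outside the stable image leaves the
descending images at some stage. -/
theorem exists_mem_stableImage (φ : FreeGroup (Fin n) →* FreeGroup (Fin n)) (L : ℕ) :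
    ∃ K, ∀ k ≥ K, ∀ x ∈ (iter φ k).range, x.norm ≤ L → x ∈ stableImage φ := by
  have h : ∀ x : FreeGroup (Fin n), ∃ K, x ∉ stableImage φ → x ∉ (iter φ K).range := by
    intro x
    by_cases hx : x ∈ stableImage φ
    · exact ⟨0, fun h => absurd hx h⟩
    · rw [stableImage, Subgroup.mem_iInf, not_forall] at hx
      obtain ⟨K, hK⟩ := hx
      exact ⟨K, fun _ => hK⟩
  choose K hK using h
  obtain ⟨M, hM⟩ := ((finite_norm_le (β := Fin n) L).image K).bddAbove
  refine ⟨M, fun k hk x hx hxL => ?_⟩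
  by_contra hne
  exact hK x hne (range_iter_antitone φ ((hM ⟨x, hxL, rfl⟩).trans hk) hx)

/-- The stable image of an injective endomorphism is a free factor of the image of some iterate. -/
theorem exists_stableImage_eq_map (hφ : Function.Injective φ) :
    ∃ (k : ℕ) (α : FreeGroup (Fin n) ≃* FreeGroup (Fin n)) (S : Set (Fin n)),
      stableImage φ = (Subgroup.closure (FreeGroup.of '' S)).map ((iter φ k).comp α.toMonoidHom) := by
  choose α hα using fun k => exists_isNielsenReduced_of_injective (iter_injective hφ k)
  choose K hK using exists_mem_stableImage φ
  let S (k L : ℕ) : Set (Fin n) := {i | (iter φ k (α k (FreeGroup.of i))).norm ≤ L}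
  let f (k : ℕ) := (iter φ k).comp (α k).toMonoidHom
  have hf : ∀ k, Function.Injective (f k) := fun k => (iter_injective hφ k).comp (α k).injective
  let T (L : ℕ) := Subgroup.closure {x | x ∈ stableImage φ ∧ x.norm ≤ L}
  -- For `k` past `K L`, short elements of the `k`-th image are exactly the short stable ones, and
  -- they are products of short elements of its Nielsen reduced basis.
  have hT : ∀ L k, K L ≤ k → T L = (Subgroup.closure (FreeGroup.of '' S k L)).map (f k) := by
    intro L k hk
    apply le_antisymm
    · rw [Subgroup.closure_le]
      rintro x ⟨hx, hxL⟩
      obtain ⟨g, rfl⟩ := Subgroup.mem_iInf.1 hx k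
      obtain ⟨g, rfl⟩ := (α k).surjective g
      refine ⟨g, mem_closure_of_image_iff.2 fun a ha => ?_, rfl⟩
      refine ((hα k).norm_letter_le g ha).trans ?_
      rwa [lift_basis]
    · rw [MonoidHom.map_closure, Subgroup.closure_le]
      rintro _ ⟨_, ⟨i, hi, rfl⟩, rfl⟩
      exact Subgroup.subset_closure ⟨hK L k hk _ ⟨_, rfl⟩ hi, hi⟩
  -- The ranks of the increasing subgroups `T L` are at most `n`; where the rank is maximal the
  -- sequence stabilises, and the union of the `T L` is the stable image.
  let C : Set ℕ := {c | ∃ L k, K L ≤ k ∧ (S k L).ncard = c}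
  have hC : BddAbove C := by
    refine ⟨n, ?_⟩
    rintro _ ⟨L, k, -, rfl⟩
    simpa using Set.ncard_le_ncard (Set.subset_univ (S k L))
  obtain ⟨L, k, hk, hmax⟩ := Nat.sSup_mem (s := C) ⟨_, 0, K 0, le_rfl, rfl⟩ hC
  have hTL : ∀ L', L ≤ L' → T L' = T L := by
    intro L' hL
    -- At a common stage `k'` both subgroups are generated by parts of one basis, so inclusion
    -- together with equal rank gives equality.
    set k' := max (K L) (K L')
    have h₁ := hT L k' (le_max_left _ _)
    have h₂ := hT L' k' (le_max_right _ _)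
    have hcard := ncard_eq_of_map_closure_eq (hf k) (hf k') ((hT L k hk).symm.trans h₁)
    have hle : (S k' L').ncard ≤ (S k' L).ncard := by
      rw [← hcard, hmax]
      exact le_csSup hC ⟨L', k', le_max_right _ _, rfl⟩
    have hsub : S k' L ⊆ S k' L' := fun i hi => le_trans hi hL
    rw [h₁, h₂, Set.eq_of_subset_of_ncard_le hsub hle]
  refine ⟨k, α k, S k L, le_antisymm ?_ ?_⟩
  · intro x hx
    rw [← hT L k hk, ← hTL (max L x.norm) (le_max_left _ _)]
    exact Subgroup.subset_closure ⟨hx, le_max_right _ _⟩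
  · rw [← hT L k hk, Subgroup.closure_le]
    exact fun x hx => hx.1

theorem apply_mem_stableImage {g : FreeGroup (Fin n)} (hg : g ∈ stableImage φ) :
    φ g ∈ stableImage φ := by
  refine Subgroup.mem_iInf.2 fun k => ?_
  obtain ⟨h, rfl⟩ := Subgroup.mem_iInf.1 hg k
  exact ⟨φ h, by rw [iter_apply, iter_apply, ← Function.iterate_succ_apply,
    Function.iterate_succ_apply']⟩

theorem IsIrreducible.stableImage_eq_bot (hφ : IsIrreducible φ) (hna : ¬ Function.Bijective φ) :
    stableImage φ = ⊥ := by
  have hinj := hφ.injective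
  obtain ⟨k, α, S, hS⟩ := exists_stableImage_eq_map hinj
  have hmem : ∀ g, iter φ k (α g) ∈ stableImage φ ↔ ∀ a ∈ g.toWord, a.1 ∈ S := by
    intro g
    rw [← mem_closure_of_image_iff, hS]
    exact Subgroup.mem_map_iff_mem (f := (iter φ k).comp α.toMonoidHom)
      ((iter_injective hinj k).comp α.injective)
  rcases S.eq_empty_or_nonempty with rfl | hne
  · rw [hS, Set.image_empty, Subgroup.closure_empty, Subgroup.map_bot]
  · exfalso
    -- Since `φ` commutes with its iterates and preserves the stable image, it preserves the free
    -- factor spanned by `S`.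
    have hinv : S = Set.univ := by
      refine hφ.eq_univ_of_invariant α hne fun s hs => ?_
      rw [← hmem, MulEquiv.apply_symm_apply, iter_apply, ← Function.iterate_succ_apply,
        Function.iterate_succ_apply', ← iter_apply]
      exact apply_mem_stableImage ((hmem _).2 (by simpa using hs))
    refine hna ⟨hinj, fun g => ?_⟩
    have hg : iter φ k g ∈ stableImage φ := by
      rw [← α.apply_symm_apply g, hmem]
      simp [hinv]
    -- Now `φ^k(g)` equals `φ^(k+1)(h)`, and cancelling the injective `φ^k` shows that `φ` is onto.
    obtain ⟨h, hh⟩ := Subgroup.mem_iInf.1 hg (k + 1)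
    refine ⟨h, iter_injective hinj k ?_⟩
    rw [← hh, iter_apply, iter_apply, Function.iterate_succ_apply]

theorem IsIrreducible.exists_eq_one_of_norm_iter_le (hφ : IsIrreducible φ)
    (hna : ¬ Function.Bijective φ) (L : ℕ) :
    ∃ K, ∀ k ≥ K, ∀ g, (iter φ k g).norm ≤ L → g = 1 := by
  obtain ⟨K, hK⟩ := exists_mem_stableImage φ L
  refine ⟨K, fun k hk g hg => ?_⟩
  have h := hK k hk _ ⟨g, rfl⟩ hg
  rw [hφ.stableImage_eq_bot hna, Subgroup.mem_bot] at h
  exact (map_eq_one_iff _ (iter_injective hφ.injective k)).1 h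

theorem IsIrreducible.exists_finset_prefixes (hφ : IsIrreducible φ)
    (hna : ¬ Function.Bijective φ) (r : ℕ) :
    ∃ k, ∃ W : Finset (List (Fin n × Bool)), W.card ≤ 2 * n ∧
      ∀ g, g ≠ 1 → (iter φ k g).toWord.take r ∈ W := by
  obtain ⟨k, hk⟩ := hφ.exists_eq_one_of_norm_iter_le hna (2 * r)
  obtain ⟨α, hα⟩ := exists_isNielsenReduced_of_injective (iter_injective hφ.injective k)
  refine ⟨k, Finset.univ.image fun a =>
    (letterVal (fun i => iter φ k (α (FreeGroup.of i))) a).toWord.take r, ?_, fun g hg => ?_⟩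
  · refine Finset.card_image_le.trans ?_
    rw [Finset.card_univ, Fintype.card_prod, Fintype.card_fin, Fintype.card_bool, mul_comm]
  · obtain ⟨g, rfl⟩ := α.surjective g
    have hr : ∀ i, 2 * r ≤ (iter φ k (α (FreeGroup.of i))).norm := by
      intro i
      by_contra! hlt
      have := hk k le_rfl _ hlt.le
      exact hα.ne_one i (by rw [this, map_one])
    have hg' : g ≠ 1 := by
      rintro rfl
      exact hg (map_one α)
    obtain ⟨a, ha⟩ := hα.take_toWord_lift hr hg'
    rw [lift_basis] at ha
    rw [ha]
    exact Finset.mem_image_of_mem _ (Finset.mem_univ a)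

end Iterates

/-! ### Finite attractors of continuous maps -/

section Attractor

variable {α : Type*} [TopologicalSpace α] {h : α → α} {Λ : Set α}

/-- The images of the iterates of `h` are eventually contained in every neighbourhood of `Λ`. -/
def Absorbs (h : α → α) (Λ : Set α) : Prop :=
  ∀ U, IsOpen U → Λ ⊆ U → ∃ K, ∀ k ≥ K, ∀ x, h^[k] x ∈ U

theorem Absorbs.iterate (H : Absorbs h Λ) {p : ℕ} (hp : 1 ≤ p) : Absorbs h^[p] Λ := by
  intro U hU hΛ
  obtain ⟨K, hK⟩ := H U hU hΛ
  refine ⟨K, fun k hk x => ?_⟩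
  rw [← Function.iterate_mul]
  exact hK _ (hk.trans (Nat.le_mul_of_pos_left k hp)) x

theorem Absorbs.fixedPoints_subset [T1Space α] (H : Absorbs h Λ) :
    Function.fixedPoints h ⊆ Λ := by
  intro x hx
  by_contra hne
  obtain ⟨K, hK⟩ := H {x}ᶜ isOpen_compl_singleton (Set.subset_compl_singleton_iff.2 hne)
  exact hK K le_rfl x (Function.IsFixedPt.iterate hx K)

theorem Absorbs.isAttractingFixedPt [T2Space α] (H : Absorbs h Λ) (hΛ : Λ.Finite)
    (hc : Continuous h) {x : α} (hx : Function.IsFixedPt h x) : IsAttractingFixedPt h x := by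
  have hxΛ : x ∈ Λ := H.fixedPoints_subset hx
  obtain ⟨W, hW, hdisj⟩ := hΛ.t2_separation
  -- Late iterates lie in `V` or near another point of `Λ`; the disjointness of the `W y` rules out
  -- the latter inside `W x`.
  have habs : ∀ V, IsOpen V → x ∈ V → ∃ K, ∀ k ≥ K, ∀ y, h^[k] y ∈ W x → h^[k] y ∈ V := by
    intro V hV hxV
    obtain ⟨K, hK⟩ := H (V ∪ ⋃ y ∈ Λ \ {x}, W y)
      (hV.union (isOpen_biUnion fun y _ => (hW y).2)) (by
        intro y hy
        by_cases hyx : y = x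
        · exact Or.inl (hyx ▸ hxV)
        · exact Or.inr (Set.mem_biUnion (⟨hy, hyx⟩ : y ∈ Λ \ {x}) (hW y).1))
    refine ⟨K, fun k hk y hy => ?_⟩
    rcases hK k hk y with h₁ | h₁
    · exact h₁
    · obtain ⟨z, hz, hyz⟩ := Set.mem_iUnion₂.1 h₁
      exact absurd hy (Set.disjoint_left.1 (hdisj hz.1 hxΛ hz.2) hyz)
  -- With this choice of `V` the next iterate is again in `W x`, so an orbit that is in `W x` at
  -- time `K` never leaves it.
  obtain ⟨K, hK⟩ := habs (W x ∩ h ⁻¹' W x) ((hW x).2.inter ((hW x).2.preimage hc))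
    ⟨(hW x).1, by rw [Set.mem_preimage, hx]; exact (hW x).1⟩
  have htrap : ∀ y, h^[K] y ∈ W x → ∀ k ≥ K, h^[k] y ∈ W x := by
    intro y hy k hk
    induction k, hk using Nat.le_induction with
    | base => exact hy
    | succ k hk ih =>
      rw [Function.iterate_succ_apply']
      exact (hK k hk y ih).2
  refine ⟨hx, h^[K] ⁻¹' W x, ?_, fun V hV => ?_⟩
  · refine ((hW x).2.preimage (hc.iterate K)).mem_nhds ?_
    rw [Set.mem_preimage, Function.IsFixedPt.iterate hx K]
    exact (hW x).1
  · obtain ⟨V', hV', hopen, hxV⟩ := mem_nhds_iff.1 hV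
    obtain ⟨K', hK'⟩ := habs V' hopen hxV
    exact ⟨max K K', fun k hk y hy =>
      hV' (hK' k (le_of_max_le_right hk) y (htrap y hy k (le_of_max_le_left hk)))⟩

theorem antitone_range_iterate {α : Type*} (h : α → α) :
    Antitone fun k => Set.range h^[k] := by
  refine antitone_nat_of_succ_le fun k => ?_
  rintro _ ⟨x, rfl⟩
  exact ⟨h x, (Function.iterate_succ_apply h k x).symm⟩

theorem absorbs_iInter_range [CompactSpace α] [T2Space α] (hc : Continuous h) :
    Absorbs h (⋂ k, Set.range h^[k]) := by
  intro U hU hΛ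
  obtain ⟨K, hK⟩ := exists_subset_nhds_of_compactSpace
    (antitone_range_iterate h).directed_ge
    (fun k => (isCompact_range (hc.iterate k)).isClosed) fun x hx => hU.mem_nhds (hΛ hx)
  exact ⟨K, fun k hk x => hK (antitone_range_iterate h hk ⟨x, rfl⟩)⟩

/-- The fibre over `y` meets every range, and these nested compact sets have a common point. -/
theorem surjOn_iInter_range [CompactSpace α] [T2Space α] (hc : Continuous h) :
    Set.SurjOn h (⋂ k, Set.range h^[k]) (⋂ k, Set.range h^[k]) := by
  intro y hy
  have hclosed : ∀ k, IsClosed (h ⁻¹' {y} ∩ Set.range h^[k]) := fun k =>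
    (isClosed_singleton.preimage hc).inter (isCompact_range (hc.iterate k)).isClosed
  obtain ⟨x, hx⟩ := IsCompact.nonempty_iInter_of_directed_nonempty_isCompact_isClosed
    (fun k => h ⁻¹' {y} ∩ Set.range h^[k])
    (Antitone.directed_ge fun i j hij =>
      Set.inter_subset_inter_right _ (antitone_range_iterate h hij))
    (fun k => by
      obtain ⟨z, hz⟩ := Set.mem_iInter.1 hy (k + 1)
      exact ⟨h^[k] z, by rw [← hz, Function.iterate_succ_apply']; rfl, z, rfl⟩)
    (fun k => (hclosed k).isCompact) hclosed
  rw [Set.mem_iInter] at hx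
  exact ⟨x, Set.mem_iInter.2 fun k => (hx k).2, (hx 0).1⟩

theorem mapsTo_iInter_range {α : Type*} (h : α → α) :
    Set.MapsTo h (⋂ k, Set.range h^[k]) (⋂ k, Set.range h^[k]) := by
  intro x hx
  refine Set.mem_iInter.2 fun k => ?_
  obtain ⟨z, rfl⟩ := Set.mem_iInter.1 hx k
  exact ⟨h z, by rw [← Function.iterate_succ_apply, Function.iterate_succ_apply']⟩

theorem exists_iterate_eq_self {α : Type*} {h : α → α} {Λ : Set α} (hfin : Λ.Finite)
    (hm : Set.MapsTo h Λ Λ) (hs : Set.SurjOn h Λ Λ) :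
    ∃ p, 1 ≤ p ∧ ∀ x ∈ Λ, h^[p] x = x := by
  have := hfin.to_subtype
  let e := Equiv.ofBijective _ (Finite.injective_iff_bijective.1
    (Finite.injective_iff_surjective.2 (hm.restrict_surjective_iff.2 hs)))
  have he : ∀ (k : ℕ) (x : Λ), ((e ^ k) x : α) = h^[k] x := by
    intro k
    induction k with
    | zero => exact fun x => rfl
    | succ k ih =>
      intro x
      rw [pow_succ, Equiv.Perm.mul_apply, ih, Function.iterate_succ_apply]
      rfl
  refine ⟨orderOf e, orderOf_pos e, fun x hx => ?_⟩
  rw [← he _ ⟨x, hx⟩, pow_orderOf_eq_one]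
  rfl

end Attractor

/-! ### The boundary map of an injective endomorphism -/

section BoundaryMap

variable {n : ℕ}

/-- The word formed by the first `m` letters of a boundary point. -/
def initialWord (X : Boundary n) (m : ℕ) : List (Fin n × Bool) := (List.range m).map X.1

@[simp] theorem length_initialWord (X : Boundary n) (m : ℕ) : (initialWord X m).length = m := by
  simp [initialWord]

theorem take_initialWord (X : Boundary n) {m k : ℕ} (h : m ≤ k) :
    (initialWord X k).take m = initialWord X m := by
  rw [initialWord, ← List.map_take, List.take_range, min_eq_left h, initialWord]

theorem initialWord_eq_iff {X Y : Boundary n} {m : ℕ} :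
    initialWord X m = initialWord Y m ↔ ∀ i < m, X.1 i = Y.1 i := by
  simp [initialWord, List.map_inj_left]

theorem isReduced_initialWord (X : Boundary n) (m : ℕ) :
    FreeGroup.IsReduced (initialWord X m) := by
  refine List.isChain_iff_getElem.2 fun i hi h => ?_
  simp only [initialWord, List.getElem_map, List.getElem_range] at h ⊢
  by_contra hne
  refine X.2 i (Prod.ext h.symm ?_)
  revert hne
  generalize (X.1 i).2 = a
  generalize (X.1 (i + 1)).2 = b
  cases a <;> cases b <;> simp

theorem toWord_initialSegment (X : Boundary n) (m : ℕ) :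
    (initialSegment X m).toWord = initialWord X m :=
  toWord_mk_of_isReduced (isReduced_initialWord X m)

theorem convergesTo_initialSegment (X : Boundary n) : ConvergesTo (initialSegment X) X := by
  intro m
  filter_upwards [eventually_ge_atTop m] with k hk
  rw [toWord_initialSegment, take_initialWord X hk, initialWord]

theorem eq_of_initialWord_eq {X Y : Boundary n} (h : ∀ m, initialWord X m = initialWord Y m) :
    X = Y :=
  Subtype.ext <| funext fun i => initialWord_eq_iff.1 (h (i + 1)) i (Nat.lt_succ_self i)

theorem ConvergesTo.eq {g : ℕ → FreeGroup (Fin n)} {X Y : Boundary n} (hX : ConvergesTo g X)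
    (hY : ConvergesTo g Y) : X = Y := by
  refine eq_of_initialWord_eq fun m => ?_
  obtain ⟨k, h₁, h₂⟩ := ((hX m).and (hY m)).exists
  exact h₁.symm.trans h₂

theorem exists_boundary_of_prefixes {P : ℕ → List (Fin n × Bool)} (hlen : ∀ m, (P m).length = m)
    (htake : ∀ m k, m ≤ k → (P k).take m = P m) (hred : ∀ m, FreeGroup.IsReduced (P m)) :
    ∃ X : Boundary n, ∀ m, initialWord X m = P m := by
  have hget : ∀ i m, (hi : i < m) → (P m)[i]'(by rw [hlen]; exact hi) =
      (P (i + 1))[i]'(by rw [hlen]; exact Nat.lt_succ_self i) := by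
    intro i m hi
    have := htake (i + 1) m hi
    simp only [← this, List.getElem_take]
  refine ⟨⟨fun i => (P (i + 1))[i]'(by rw [hlen]; exact Nat.lt_succ_self i), fun i h => ?_⟩,
    fun m => ?_⟩
  · have h₁ := List.isChain_iff_getElem.1 (hred (i + 2)) i (by rw [hlen]; omega)
    rw [hget i (i + 2) (by omega)] at h₁
    dsimp only at h
    rw [h] at h₁
    simp at h₁
  · refine List.ext_getElem (by simp [hlen]) fun i h₁ h₂ => ?_
    simp only [initialWord, List.getElem_map, List.getElem_range]
    rw [hget i m (by simpa using h₁)]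

variable {φ : FreeGroup (Fin n) →* FreeGroup (Fin n)}

/-- By injectivity only finitely many elements have short images. Once the image has length at least
`m + C`, with `C` bounding the images of generators, appending a letter cannot disturb its first `m`
letters. -/
theorem exists_prefix_stable (hφ : Function.Injective φ) (m : ℕ) :
    ∃ M, ∀ l, FreeGroup.IsReduced l → M ≤ l.length → m ≤ (φ (FreeGroup.mk l)).norm ∧
      (φ (FreeGroup.mk l)).toWord.take m = (φ (FreeGroup.mk (l.take M))).toWord.take m := by
  obtain ⟨C, hC⟩ : ∃ C, ∀ i, (φ (FreeGroup.of i)).norm ≤ C := by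
    obtain ⟨C, hC⟩ := (Set.finite_range fun i => (φ (FreeGroup.of i)).norm).bddAbove
    exact ⟨C, fun i => hC ⟨i, rfl⟩⟩
  obtain ⟨M, hM⟩ : ∃ M, ∀ g, M ≤ g.norm → m + C ≤ (φ g).norm := by
    obtain ⟨M, hM⟩ := (((finite_norm_le (β := Fin n) (m + C)).preimage hφ.injOn).image
      FreeGroup.norm).bddAbove
    refine ⟨M + 1, fun g hg => ?_⟩
    by_contra! hlt
    have := hM ⟨g, hlt.le, rfl⟩
    omega
  have hnorm : ∀ l : List (Fin n × Bool), FreeGroup.IsReduced l →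
      (FreeGroup.mk l).norm = l.length := by
    intro l hl
    rw [FreeGroup.norm, toWord_mk_of_isReduced hl]
  have hletter : ∀ a, (φ (FreeGroup.mk [a])).norm ≤ C := by
    rintro ⟨i, b⟩
    cases b
    · have : FreeGroup.mk [(i, false)] = (FreeGroup.of i)⁻¹ := rfl
      rw [this, map_inv, FreeGroup.norm_inv_eq]
      exact hC i
    · exact hC i
  have hstep : ∀ q p : List (Fin n × Bool), M ≤ p.length → FreeGroup.IsReduced (p ++ q) →
      (φ (FreeGroup.mk (p ++ q))).toWord.take m = (φ (FreeGroup.mk p)).toWord.take m := by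
    intro q p hp
    induction q using List.reverseRecOn with
    | nil => simp
    | append_singleton q a ih =>
      intro hred
      rw [← List.append_assoc] at hred ⊢
      have hred' := (isReduced_append_iff.1 hred).1
      rw [← FreeGroup.mul_mk, map_mul, take_toWord_mul, ih hred']
      have := hM (FreeGroup.mk (p ++ q)) (by rw [hnorm _ hred', List.length_append]; omega)
      have := hletter a
      omega
  refine ⟨M, fun l hl hM' => ⟨?_, ?_⟩⟩
  · have := hM (FreeGroup.mk l) (by rwa [hnorm l hl])
    omega
  · have := hstep (l.drop M) (l.take M) (by simpa using hM')
    rw [List.take_append_drop] at this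
    exact this hl

/-- The modulus `M` does not depend on `X`; it serves both for convergence and for continuity. -/
theorem exists_modulus (hφ : Function.Injective φ) :
    ∃ M : ℕ → ℕ, ∀ X : Boundary n, ∃ Y : Boundary n, ∀ m (g : FreeGroup (Fin n)),
      g.toWord.take (M m) = initialWord X (M m) → (φ g).toWord.take m = initialWord Y m := by
  choose M hM using fun m => exists_prefix_stable hφ m
  have key : ∀ X : Boundary n, ∀ m (g : FreeGroup (Fin n)),
      g.toWord.take (M m) = initialWord X (M m) → m ≤ (φ g).norm ∧
        (φ g).toWord.take m = (φ (initialSegment X (M m))).toWord.take m := by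
    intro X m g hg
    have hl : M m ≤ g.toWord.length := by
      have := congrArg List.length hg
      rw [List.length_take, length_initialWord] at this
      omega
    have h := hM m g.toWord FreeGroup.isReduced_toWord hl
    rwa [hg, FreeGroup.mk_toWord] at h
  refine ⟨M, fun X => ?_⟩
  have hseg : ∀ m k, M m ≤ k → m ≤ (φ (initialSegment X k)).norm ∧
      (φ (initialSegment X k)).toWord.take m = (φ (initialSegment X (M m))).toWord.take m := by
    intro m k hk
    exact key X m _ (by rw [toWord_initialSegment, take_initialWord X hk])
  obtain ⟨Y, hY⟩ := exists_boundary_of_prefixes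
    (P := fun m => (φ (initialSegment X (M m))).toWord.take m)
    (fun m => by
      rw [List.length_take]
      exact min_eq_left (hseg m _ le_rfl).1)
    (fun m k hmk => by
      have h₁ := (hseg m _ (le_max_left (M m) (M k))).2
      have h₂ := (hseg k _ (le_max_right (M m) (M k))).2
      rw [← h₂, List.take_take, min_eq_left hmk, h₁])
    (fun m => by
      have h : FreeGroup.IsReduced (φ (initialSegment X (M m))).toWord :=
        FreeGroup.isReduced_toWord
      exact List.IsChain.take h m)
  exact ⟨Y, fun m g hg => by rw [hY, (key X m g hg).2]⟩

theorem exists_modulus_boundaryMap (hφ : Function.Injective φ) :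
    ∃ M : ℕ → ℕ, ∀ (X : Boundary n) m (g : FreeGroup (Fin n)),
      g.toWord.take (M m) = initialWord X (M m) →
        (φ g).toWord.take m = initialWord (boundaryMap φ X) m := by
  obtain ⟨M, hM⟩ := exists_modulus hφ
  refine ⟨M, fun X => ?_⟩
  obtain ⟨Y, hY⟩ := hM X
  have hconv : ConvergesTo (fun k => φ (initialSegment X k)) Y := by
    intro m
    filter_upwards [convergesTo_initialSegment X (M m)] with k hk
    exact hY m _ hk
  have hex : ∃ Y, ConvergesTo (fun k => φ (initialSegment X k)) Y := ⟨Y, hconv⟩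
  have : boundaryMap φ X = Y := by
    rw [boundaryMap, dif_pos hex]
    exact hex.choose_spec.eq hconv
  rw [this]
  exact hY

theorem exists_initialWord_subset_of_mem_nhds {X : Boundary n} {U : Set (Boundary n)}
    (hU : U ∈ 𝓝 X) : ∃ m, ∀ Y : Boundary n, initialWord Y m = initialWord X m → Y ∈ U := by
  rw [nhds_subtype_eq_comap, Filter.mem_comap] at hU
  obtain ⟨V, hV, hVU⟩ := hU
  rw [nhds_pi, Filter.mem_pi] at hV
  obtain ⟨I, hI, t, ht, htV⟩ := hV
  obtain ⟨m, hm⟩ := hI.bddAbove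
  refine ⟨m + 1, fun Y hY => hVU (htV fun i hi => ?_)⟩
  have := initialWord_eq_iff.1 hY i (Nat.lt_succ_of_le (hm hi))
  change Y.1 i ∈ t i
  rw [this]
  exact mem_of_mem_nhds (ht i)

theorem eventually_initialWord_eq (X : Boundary n) (m : ℕ) :
    ∀ᶠ Y in 𝓝 X, initialWord Y m = initialWord X m := by
  have h : ∀ i ∈ Set.Iio m, ∀ᶠ Y : Boundary n in 𝓝 X, Y.1 i = X.1 i := by
    intro i _
    have hc : Continuous fun Y : Boundary n => Y.1 i :=
      (continuous_apply i).comp continuous_subtype_val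
    exact hc.continuousAt.eventually_mem (IsOpen.mem_nhds (isOpen_discrete {X.1 i}) rfl)
  filter_upwards [(Filter.eventually_all_finite (Set.finite_Iio m)).2 h] with Y hY
  exact initialWord_eq_iff.2 hY

instance : CompactSpace (Boundary n) := by
  have hclosed : IsClosed {X : ℕ → Fin n × Bool | ∀ i, X (i + 1) ≠ ((X i).1, !(X i).2)} := by
    rw [Set.ofPred_forall]
    refine isClosed_iInter fun i => ?_
    have hc : Continuous fun X : ℕ → Fin n × Bool => (X i, X (i + 1)) := by fun_prop
    exact (isClosed_discrete
      {q : (Fin n × Bool) × (Fin n × Bool) | q.2 ≠ (q.1.1, !q.1.2)}).preimage hc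
  exact isCompact_iff_compactSpace.1 hclosed.isCompact

theorem isBoundaryExtension_boundaryMap (hφ : Function.Injective φ) :
    IsBoundaryExtension φ (boundaryMap φ) := by
  obtain ⟨M, hM⟩ := exists_modulus_boundaryMap hφ
  refine ⟨fun g X hg m => ?_, continuous_iff_continuousAt.2 fun X U hU => ?_⟩
  · filter_upwards [hg (M m)] with k hk
    exact hM X m _ hk
  · obtain ⟨m, hm⟩ := exists_initialWord_subset_of_mem_nhds hU
    rw [Filter.mem_map]
    filter_upwards [eventually_initialWord_eq X (M m)] with Y hY
    apply hm
    -- One finite word approximates both `X` and `Y`, so both images share its image's first `m`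
    -- letters.
    rw [← hM X m (initialSegment X (M m)), ← hM Y m (initialSegment X (M m))]
    · rw [toWord_initialSegment, take_initialWord X le_rfl, hY]
    · rw [toWord_initialSegment, take_initialWord X le_rfl]

theorem convergesTo_iter (hφ : Function.Injective φ) (k : ℕ) :
    ∀ (g : ℕ → FreeGroup (Fin n)) (X : Boundary n), ConvergesTo g X →
      ConvergesTo (fun j => iter φ k (g j)) ((boundaryMap φ)^[k] X) := by
  induction k with
  | zero => exact fun g X h => h
  | succ k ih => exact fun g X h => ih _ _ ((isBoundaryExtension_boundaryMap hφ).1 g X h)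

/-- Any `c + 1` distinct points would be told apart by their initial words of one common length. -/
theorem encard_le_of_forall_prefixes {Λ : Set (Boundary n)} {c : ℕ}
    (h : ∀ r, ∃ W : Finset (List (Fin n × Bool)), W.card ≤ c ∧ ∀ X ∈ Λ, initialWord X r ∈ W) :
    Λ.encard ≤ c := by
  by_contra! hlt
  obtain ⟨t, htΛ, ht⟩ := Set.exists_subset_encard_eq (Order.add_one_le_of_lt hlt)
  have htfin : t.Finite := Set.finite_of_encard_eq_coe (k := c + 1) (by rw [ht]; rfl)
  have hev : ∀ q ∈ t ×ˢ t, ∀ᶠ r in atTop, initialWord q.1 r = initialWord q.2 r → q.1 = q.2 := by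
    rintro ⟨X, Y⟩ -
    by_cases hXY : X = Y
    · exact Eventually.of_forall fun _ _ => hXY
    · obtain ⟨m, hm⟩ : ∃ m, initialWord X m ≠ initialWord Y m := by
        by_contra! h'
        exact hXY (eq_of_initialWord_eq h')
      filter_upwards [eventually_ge_atTop m] with r hr heq
      refine absurd ?_ hm
      rw [← take_initialWord X hr, ← take_initialWord Y hr]
      exact congrArg _ heq
  obtain ⟨r, hr⟩ := ((Filter.eventually_all_finite (htfin.prod htfin)).2 hev).exists
  obtain ⟨W, hW, hΛW⟩ := h r
  have hle : t.encard ≤ (W : Set (List (Fin n × Bool))).encard :=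
    Set.encard_le_encard_of_injOn (f := fun X => initialWord X r)
      (fun X hX => hΛW X (htΛ hX)) fun X hX Y hY hXY => hr (X, Y) ⟨hX, hY⟩ hXY
  rw [ht, Set.encard_coe_eq_coe_finsetCard] at hle
  have : c + 1 ≤ W.card := by exact_mod_cast hle
  omega

theorem IsIrreducible.encard_iInter_range_le (hφ : IsIrreducible φ)
    (hna : ¬ Function.Bijective φ) :
    (⋂ k, Set.range (boundaryMap φ)^[k]).encard ≤ (2 * n : ℕ) := by
  refine encard_le_of_forall_prefixes fun r => ?_
  obtain ⟨k, W, hW, hmem⟩ := hφ.exists_finset_prefixes hna r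
  refine ⟨W, hW, fun X hX => ?_⟩
  obtain ⟨Y, rfl⟩ := Set.mem_iInter.1 hX k
  have hconv := convergesTo_iter hφ.injective k _ _ (convergesTo_initialSegment Y) r
  -- A segment of length `j ≥ 1` is nontrivial, so the bound on prefixes applies to its image.
  obtain ⟨j, hj, hj1⟩ := (hconv.and (eventually_ge_atTop 1)).exists
  rw [initialWord, ← hj]
  refine hmem _ fun h => ?_
  have := congrArg List.length (toWord_initialSegment Y j)
  rw [h, FreeGroup.toWord_one, length_initialWord, List.length_nil] at this
  omega

end BoundaryMap

end FreeEndo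

theorem corollaryC (n : ℕ) (φ : FreeGroup (Fin n) →* FreeGroup (Fin n))
    (hirr : FreeEndo.IsIrreducible φ) (hna : ¬ Function.Bijective φ) :
    FreeEndo.IsBoundaryExtension φ (FreeEndo.boundaryMap φ) ∧
    ((Function.fixedPoints (FreeEndo.boundaryMap φ)).Finite ∧
      (Function.fixedPoints (FreeEndo.boundaryMap φ)).ncard ≤ 2 * n ∧
      ∀ X ∈ Function.fixedPoints (FreeEndo.boundaryMap φ),
        FreeEndo.IsAttractingFixedPt (FreeEndo.boundaryMap φ) X) ∧
    ∃ p : ℕ, 1 ≤ p ∧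
      (Function.fixedPoints (FreeEndo.boundaryMap φ)^[p]).Finite ∧
      (Function.fixedPoints (FreeEndo.boundaryMap φ)^[p]).ncard ≤ 2 * n ∧
      (∀ X ∈ Function.fixedPoints (FreeEndo.boundaryMap φ)^[p],
        FreeEndo.IsAttractingFixedPt (FreeEndo.boundaryMap φ)^[p] X) ∧
      ∀ N : Set (FreeEndo.Boundary n), IsCompact N →
        N ∈ 𝓝ˢ (Function.fixedPoints (FreeEndo.boundaryMap φ)^[p]) →
        ∃ K : ℕ, ∀ k ≥ K, (FreeEndo.boundaryMap φ)^[k] '' Set.univ ⊆ N := by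
  have hext := FreeEndo.isBoundaryExtension_boundaryMap hirr.injective
  obtain ⟨hfin, hcard⟩ := Set.encard_le_coe_iff_finite_ncard_le.1
    (hirr.encard_iInter_range_le hna)
  have habs := FreeEndo.absorbs_iInter_range hext.2
  obtain ⟨p, hp, hfix⟩ := FreeEndo.exists_iterate_eq_self hfin
    (FreeEndo.mapsTo_iInter_range _) (FreeEndo.surjOn_iInter_range hext.2)
  have habsp := habs.iterate hp
  refine ⟨hext, ⟨hfin.subset habs.fixedPoints_subset,
    (Set.ncard_le_ncard habs.fixedPoints_subset hfin).trans hcard,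
    fun X hX => habs.isAttractingFixedPt hfin hext.2 hX⟩, p, hp,
    hfin.subset habsp.fixedPoints_subset,
    (Set.ncard_le_ncard habsp.fixedPoints_subset hfin).trans hcard,
    fun X hX => habsp.isAttractingFixedPt hfin (hext.2.iterate p) hX, fun N _ hN => ?_⟩
  obtain ⟨U, hU, hΛU, hUN⟩ := mem_nhdsSet_iff_exists.1 hN
  -- The neighbourhood contains all of `Λ`, since the `p`-th power fixes it pointwise; absorption is
  -- applied to the map itself, which covers every `k ≥ K` and not just multiples of `p`.
  obtain ⟨K, hK⟩ := habs U hU fun X hX => hΛU (hfix X hX)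
  refine ⟨K, fun k hk => ?_⟩
  rintro _ ⟨X, -, rfl⟩
  exact hUN (hK k hk X)
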